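/- Let $d\ge 0$ be an integer, let $\mathbb{R}^d$ carry the Euclidean inner product, let $Y$ be a real Banach space, and let $K\subseteq Y$ be a closed convex cone with $K\cap(-K)=\{0\}$ that is finite dimensional (i.e. its linear span is finite dimensional). Write $y_1\preceq_K y_2$ if $y_2-y_1\in K$. Let $A\subseteq\mathbb{R}^d$ be a closed convex set, let $g_0,h_0:\mathbb{R}^d\to\mathbb{R}$ be convex functions, and let $G,H:\mathbb{R}^d\to Y$ be $K$-convex, i.e. $G(\alpha x_1+(1-\alpha)x_2)\preceq_K \alpha G(x_1)+(1-\alpha)G(x_2)$ for all $x_1,x_2\in\mathbb{R}^d$, $\alpha\in[0,1]$, and likewise for $H$. Put $f_0=g_0-h_0$ and $F=G-H$. Suppose that $G$ is continuous on $A$, that $H$ is continuously Fréchet differentiable on $A$ (Fréchet differentiable at every point of $A$, with $DH$ continuous on $A$), and that for some $c\ge 0$ the function $\Phi_c(x)=f_0(x)+c\,\mathrm{dist}(F(x),-K)$ is coercive on $A$, i.e. $\Phi_c(x_n)\to+\infty$ for every sequence $(x_n)\subseteq A$ with $\|x_n\|\to+\infty$. Let $t_0$ be a continuous linear functional on $Y$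 with $\langle t_0,y\rangle>0$ for all $y\in K\setminus\{0\}$. Let $\partial h_0(z)=\{v\in\mathbb{R}^d : h_0(x)\ge h_0(z)+\langle v,x-z\rangle \ \forall x\in\mathbb{R}^d\}$ and $$\mathscr{D}_s=\Big\{z\in A \;\Big|\; 0\in\operatorname{int}\big\{G(x)-H(z)-DH(z)(x-z)+k : x\in A,\ k\in K\big\}\Big\}$$ (the points of $A$ at which Slater's condition holds for the linearized problem below). For $z\in A$, $v\in\partial h_0(z)$ and $\mu\ge 0$ consider the linearized problem $$\text{minimize } g_0(x)-\langle v,x-z\rangle \quad\text{subject to}\quad G(x)-H(z)-DH(z)(x-z)\preceq_K 0,\ x\in A,\tag{1}$$ and the penalized problem $$\text{minimize over }(x,s)\in\mathbb{R}^d\times Y:\ g_0(x)-\langle v,x-z\rangle+\mu\langle t_0,s\rangle \quad\text{subject to}\quad G(x)-H(z)-DH(z)(x-z)\preceq_K s,\ 0\preceq_K s,\ x\in A.\tag{2}$$ Then for every compact set $\mathscr{D}_0\subseteq\mathscr{D}_s$ there exists $\mu_*\ge 0$ such that for all $\mu\ge\mu_*$, all $z\in\mathscr{D}_0$ and all $v\in\partial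 h_0(z)$, problem (2) has a globally optimal solution, and a pair $(x_*,s_*)$ is a globally optimal solution of (2) if and only if $s_*=0$ and $x_*$ is a globally optimal solution of (1). -/

import Mathlib

open scoped RealInnerProductSpace Pointwise

namespace ConeDC

variable {d : ℕ} {Y : Type*} [NormedAddCommGroup Y] [NormedSpace ℝ Y]

/-- `x ⪯_K y`: the relation induced by the cone `K`. -/
def ConeLE (K : ProperCone ℝ Y) (x y : Y) : Prop := y - x ∈ K

/-- Convexity of a vector-valued map on `ℝ^d` with respect to the cone `K`. -/
def KConvex (K : ProperCone ℝ Y) (Φ : EuclideanSpace ℝ (Fin d) → Y) : Prop :=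
  ∀ x₁ x₂ : EuclideanSpace ℝ (Fin d), ∀ α : ℝ, 0 ≤ α → α ≤ 1 →
    ConeLE K (Φ (α • x₁ + (1 - α) • x₂)) (α • Φ x₁ + (1 - α) • Φ x₂)

/-- Continuous Fréchet differentiability on a set: the map is Fréchet differentiable (as a map on
the whole space) at every point of the set and its derivative is continuous on the set. -/
def ContDiffFrechetOn (H : EuclideanSpace ℝ (Fin d) → Y) (A : Set (EuclideanSpace ℝ (Fin d))) :
    Prop :=
  (∀ x ∈ A, DifferentiableAt ℝ H x) ∧ ContinuousOn (fderiv ℝ H) A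

/-- `φ(x_n) → +∞` for every sequence in `A` with `‖x_n‖ → +∞`. -/
def CoerciveOn (φ : EuclideanSpace ℝ (Fin d) → ℝ) (A : Set (EuclideanSpace ℝ (Fin d))) : Prop :=
  ∀ u : ℕ → EuclideanSpace ℝ (Fin d), (∀ n, u n ∈ A) →
    Filter.Tendsto (fun n => ‖u n‖) Filter.atTop Filter.atTop →
    Filter.Tendsto (fun n => φ (u n)) Filter.atTop Filter.atTop

/-- The penalty function `Φ_c(x) = f₀(x) + c dist(F(x), -K)` with `f₀ = g₀ - h₀`, `F = G - H`. -/
noncomputable def penaltyFun (K : ProperCone ℝ Y) (g₀ h₀ : EuclideanSpace ℝ (Fin d) → ℝ)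
    (G H : EuclideanSpace ℝ (Fin d) → Y) (c : ℝ) (x : EuclideanSpace ℝ (Fin d)) : ℝ :=
  (g₀ x - h₀ x) + c * Metric.infDist (G x - H x) (-(K : Set Y))

/-- The subdifferential of a convex function `h : ℝ^d → ℝ` at `z`. -/
def subdifferential (h : EuclideanSpace ℝ (Fin d) → ℝ) (z : EuclideanSpace ℝ (Fin d)) :
    Set (EuclideanSpace ℝ (Fin d)) :=
  {v | ∀ x, h z + ⟪v, x - z⟫ ≤ h x}

/-- The partially linearized map `F_z(x) = G(x) - H(z) - DH(z)(x - z)`. -/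
noncomputable def linearized (G H : EuclideanSpace ℝ (Fin d) → Y)
    (z x : EuclideanSpace ℝ (Fin d)) : Y :=
  G x - H z - fderiv ℝ H z (x - z)

/-- The points `z ∈ A` with `0 ∈ int {F_z(x) + K | x ∈ A}`. -/
def slaterSet (K : ProperCone ℝ Y) (A : Set (EuclideanSpace ℝ (Fin d)))
    (G H : EuclideanSpace ℝ (Fin d) → Y) : Set (EuclideanSpace ℝ (Fin d)) :=
  {z | z ∈ A ∧ (0 : Y) ∈ interior {y : Y | ∃ x ∈ A, ∃ k ∈ K, y = linearized G H z x + k}}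

/-- `t ≻_{K^*} 0`: `t` lies in the dual cone and `⟨t, y⟩ > 0` for all `y ∈ K`, `y ≠ 0`. -/
def StrictlyDualPositive (K : ProperCone ℝ Y) (t : Y →L[ℝ] ℝ) : Prop :=
  (∀ y ∈ K, 0 ≤ t y) ∧ ∀ y ∈ K, y ≠ 0 → 0 < t y

/-- `p` is a globally optimal solution of: minimize `f` over the feasible region `S`. -/
def IsSolution {E : Type*} (f : E → ℝ) (S : Set E) (p : E) : Prop :=
  p ∈ S ∧ ∀ q ∈ S, f p ≤ f q

/-- Objective `g₀(x) - ⟨v, x - z⟩` of the linearized problem. -/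
noncomputable def objective (g₀ : EuclideanSpace ℝ (Fin d) → ℝ) (z v : EuclideanSpace ℝ (Fin d))
    (x : EuclideanSpace ℝ (Fin d)) : ℝ :=
  g₀ x - ⟪v, x - z⟫

/-- Feasible region of the linearized problem: `F_z(x) ⪯_K 0`, `x ∈ A`. -/
def feasible (K : ProperCone ℝ Y) (A : Set (EuclideanSpace ℝ (Fin d)))
    (G H : EuclideanSpace ℝ (Fin d) → Y) (z : EuclideanSpace ℝ (Fin d)) :
    Set (EuclideanSpace ℝ (Fin d)) :=
  {x | ConeLE K (linearized G H z x) 0 ∧ x ∈ A}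

/-- Objective `g₀(x) - ⟨v, x - z⟩ + μ ⟨t₀, s⟩` of the penalized problem. -/
noncomputable def penObjective (g₀ : EuclideanSpace ℝ (Fin d) → ℝ) (t₀ : Y →L[ℝ] ℝ) (μ : ℝ)
    (z v : EuclideanSpace ℝ (Fin d)) (p : EuclideanSpace ℝ (Fin d) × Y) : ℝ :=
  g₀ p.1 - ⟪v, p.1 - z⟫ + μ * t₀ p.2

/-- Feasible region of the penalized problem: `F_z(x) ⪯_K s`, `s ⪰_K 0`, `x ∈ A`. -/
def penFeasible (K : ProperCone ℝ Y) (A : Set (EuclideanSpace ℝ (Fin d)))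
    (G H : EuclideanSpace ℝ (Fin d) → Y) (z : EuclideanSpace ℝ (Fin d)) :
    Set (EuclideanSpace ℝ (Fin d) × Y) :=
  {p | ConeLE K (linearized G H z p.1) p.2 ∧ ConeLE K 0 p.2 ∧ p.1 ∈ A}

end ConeDC

/-! This is exact penalization with a constant uniform in `z` and `v`. Slater's condition provides
points whose constraint value lies below any small vector. Mixing a penalized-feasible `(x, s)` with
a Slater point for a multiple of `-s` cancels the slack and costs at most `L * ‖s‖`
(`exists_feasible_objective_le`). On `K` the functional `t₀` dominates `σ * ‖s‖`, so once `μ * σ ≥ L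
+ 1` a nonzero slack never pays.

Uniformity of `L` needs three bounds. A common Slater ball, reached from a bounded part of `A`,
comes from Baire's theorem at each `z`, stability under small perturbations, and compactness
(`exists_uniform_slater`). The objective is bounded below by the coercive penalty function, up to `c
* ‖s‖`, and above at Slater points by a bound free of `v`. Coercivity also yields a solution of the
linearized problem. -/

namespace ConeDC

/-! ### Convex sets and cones in normed spaces -/

section ConvexSets

variable {Y : Type*} [NormedAddCommGroup Y] [NormedSpace ℝ Y]

/-- If a closed convex set `D` approximates every point of a ball of radius `r + ε` up to `ε`,
then it contains the ball of radius `r`. -/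
theorem ball_subset_of_forall_exists_norm_sub_le {D : Set Y} (hconv : Convex ℝ D)
    (hclosed : IsClosed D) {r ε : ℝ} (hr : 0 < r) (hε : 0 ≤ ε)
    (h : ∀ y ∈ Metric.ball (0 : Y) (r + ε), ∃ y' ∈ D, ‖y' - y‖ ≤ ε) :
    Metric.ball (0 : Y) r ⊆ D := by
  intro y hy
  rw [mem_ball_zero_iff] at hy
  by_contra hyD
  -- Separate `y` from `D`, so that `f y < f b` on `D`. Since `‖y‖ < r`, some `w` in the larger ball
  -- has `f w < -(‖y‖ + ε) * ‖f‖`; its approximant `b` in `D` then satisfies `f b < -‖y‖ * ‖f‖ ≤ f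
  -- y`.
  obtain ⟨f, u, hfy, hfu⟩ := geometric_hahn_banach_point_closed hconv hclosed hyD
  have hfpos : 0 < ‖f‖ := by
    obtain ⟨b, hb, -⟩ := h 0 (by simp; linarith)
    refine norm_pos_iff.2 fun hf => ?_
    have := hfu b hb
    simp only [hf, zero_apply] at this hfy
    linarith
  have hlt : (‖y‖ + ε) / (r + ε) * ‖f‖ < ‖f‖ := by
    have : (‖y‖ + ε) / (r + ε) < 1 := by rw [div_lt_one (by linarith)]; linarith
    nlinarith
  obtain ⟨x, hx, hfx⟩ := f.exists_lt_apply_of_lt_opNorm hlt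
  obtain ⟨w, hw, hfw⟩ : ∃ w : Y, ‖w‖ < r + ε ∧ f w < -((‖y‖ + ε) * ‖f‖) := by
    have hscale : (‖y‖ + ε) * ‖f‖ < (r + ε) * ‖f x‖ := by
      have := mul_lt_mul_of_pos_left hfx (by linarith : 0 < r + ε)
      rwa [← mul_assoc, mul_div_cancel₀ _ (by linarith : r + ε ≠ 0)] at this
    have hnorm : (r + ε) * ‖x‖ < r + ε := by nlinarith
    rcases le_total 0 (f x) with h0 | h0
    · refine ⟨-((r + ε) • x), ?_, ?_⟩
      · rwa [norm_neg, norm_smul, Real.norm_of_nonneg (by linarith)]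
      · rw [Real.norm_of_nonneg h0] at hscale
        simpa using hscale
    · refine ⟨(r + ε) • x, ?_, ?_⟩
      · rwa [norm_smul, Real.norm_of_nonneg (by linarith)]
      · rw [Real.norm_of_nonpos h0] at hscale
        simp only [map_smul, smul_eq_mul]
        linarith
  obtain ⟨b, hb, hbw⟩ := h w (mem_ball_zero_iff.2 hw)
  have h1 : f b - f w ≤ ‖f‖ * ε := by
    rw [← map_sub]
    exact (Real.le_norm_self _).trans ((f.le_opNorm _).trans (by gcongr))
  have h2 : -(‖f‖ * ‖y‖) ≤ f y := (abs_le.1 (f.le_opNorm y)).1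
  have h3 := hfu b hb
  nlinarith

/-- If `0` is interior to the union of an increasing sequence of closed convex sets, then it is
interior to one of them. -/
theorem exists_zero_mem_interior_of_monotone [CompleteSpace Y] {C : ℕ → Set Y}
    (hmono : Monotone C) (hclosed : ∀ n, IsClosed (C n)) (hconv : ∀ n, Convex ℝ (C n))
    (h0 : (0 : Y) ∈ interior (⋃ n, C n)) : ∃ n, (0 : Y) ∈ interior (C n) := by
  set U := interior (⋃ n, C n)
  have hU : IsOpen U := isOpen_interior
  -- Baire: adding the complement of `U` makes the closed sets cover the whole space, so one `C n`
  -- has an interior point `p` in `U`.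
  have hdense : Dense (⋃ n, interior (C n ∪ Uᶜ)) := by
    refine dense_iUnion_interior_of_closed (fun n => (hclosed n).union hU.isClosed_compl) ?_
    refine Set.eq_univ_of_forall fun y => ?_
    by_cases hy : y ∈ U
    · obtain ⟨n, hn⟩ := Set.mem_iUnion.1 (interior_subset hy)
      exact Set.mem_iUnion.2 ⟨n, Or.inl hn⟩
    · exact Set.mem_iUnion.2 ⟨0, Or.inr hy⟩
  obtain ⟨p, hpU, hp⟩ := hdense.inter_open_nonempty U hU ⟨0, h0⟩
  obtain ⟨n, hpn⟩ := Set.mem_iUnion.1 hp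
  have hpC : p ∈ interior (C n) := by
    refine mem_interior.2 ⟨interior (C n ∪ Uᶜ) ∩ U, ?_, isOpen_interior.inter hU, hpn, hpU⟩
    rintro y ⟨hy, hyU⟩
    exact (interior_subset hy).resolve_right fun h => h hyU
  -- For small `t > 0` the opposite point `-(t • p)` lies in some `C m`, and `0` is a proper convex
  -- combination of it and the interior point `p`.
  have hcont : Filter.Tendsto (fun t : ℝ => -(t • p)) (nhdsWithin 0 (Set.Ioi 0)) (nhds 0) := by
    have : Continuous fun t : ℝ => -(t • p) := by fun_prop
    simpa using (this.tendsto 0).mono_left nhdsWithin_le_nhds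
  obtain ⟨t, htU, ht⟩ := ((hcont.eventually (hU.mem_nhds h0)).and self_mem_nhdsWithin).exists
  have ht : 0 < t := ht
  obtain ⟨m, hm⟩ := Set.mem_iUnion.1 (interior_subset htU)
  refine ⟨max n m, ?_⟩
  have := (hconv (max n m)).combo_interior_self_mem_interior
    (interior_mono (hmono (le_max_left n m)) hpC) (hmono (le_max_right n m) hm)
    (a := t / (1 + t)) (b := 1 / (1 + t)) (by positivity) (by positivity) (by field_simp; ring)
  convert this using 1
  rw [smul_neg, smul_smul, one_div_mul_eq_div, add_neg_cancel]

/-- A continuous linear functional that is positive on the nonzero elements of a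
finite-dimensional closed cone dominates a multiple of the norm there. -/
theorem StrictlyDualPositive.exists_mul_norm_le {K : ProperCone ℝ Y}
    (hK : FiniteDimensional ℝ (Submodule.span ℝ (K : Set Y))) {t : Y →L[ℝ] ℝ}
    (ht : StrictlyDualPositive K t) : ∃ σ : ℝ, 0 < σ ∧ ∀ s ∈ K, σ * ‖s‖ ≤ t s := by
  have hcompact : IsCompact {s : Y | s ∈ K ∧ ‖s‖ = 1} := by
    have hB : IsCompact
        ((Submodule.span ℝ (K : Set Y)).subtypeL '' Metric.closedBall 0 1) :=
      (isCompact_closedBall _ _).image (Submodule.subtypeL _).continuous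
    refine hB.of_isClosed_subset
      (K.isClosed.inter (isClosed_eq continuous_norm continuous_const)) ?_
    rintro s ⟨hs, hs1⟩
    exact ⟨⟨s, Submodule.subset_span hs⟩, by simp [hs1], rfl⟩
  rcases {s : Y | s ∈ K ∧ ‖s‖ = 1}.eq_empty_or_nonempty with hempty | hne
  · refine ⟨1, one_pos, fun s hs => ?_⟩
    by_cases h0 : s = 0
    · simp [h0]
    · have : ‖s‖⁻¹ • s ∈ {s : Y | s ∈ K ∧ ‖s‖ = 1} :=
        ⟨K.smul_mem hs (by positivity), by
          rw [norm_smul, norm_inv, norm_norm, inv_mul_cancel₀ (norm_ne_zero_iff.2 h0)]⟩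
      simp [hempty] at this
  · obtain ⟨e, ⟨heK, he1⟩, hmin⟩ := hcompact.exists_isMinOn hne t.continuous.continuousOn
    have he0 : e ≠ 0 := norm_ne_zero_iff.1 (by simp [he1])
    refine ⟨t e, ht.2 e heK he0, fun s hs => ?_⟩
    by_cases h0 : s = 0
    · simp [h0]
    · have hpos : 0 < ‖s‖ := norm_pos_iff.2 h0
      have := isMinOn_iff.1 hmin (‖s‖⁻¹ • s)
        ⟨K.smul_mem hs (by positivity), by
          rw [norm_smul, norm_inv, norm_norm, inv_mul_cancel₀ hpos.ne']⟩
      rw [map_smul, smul_eq_mul, ← div_eq_inv_mul, le_div_iff₀ hpos] at this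
      exact this

end ConvexSets

variable {d : ℕ} {Y : Type*} [NormedAddCommGroup Y] [NormedSpace ℝ Y] {K : ProperCone ℝ Y}
  {A : Set (EuclideanSpace ℝ (Fin d))} {G H : EuclideanSpace ℝ (Fin d) → Y}
  {g₀ h₀ : EuclideanSpace ℝ (Fin d) → ℝ}

/-! ### Cone-convex maps and their linearizations -/

/-- A `K`-convex map lies above its linearization at a point of differentiability. -/
theorem KConvex.sub_sub_fderiv_mem (hH : KConvex K H) {z : EuclideanSpace ℝ (Fin d)}
    (hz : DifferentiableAt ℝ H z) (x : EuclideanSpace ℝ (Fin d)) :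
    H x - H z - fderiv ℝ H z (x - z) ∈ K := by
  -- For `0 < t ≤ 1`, `K`-convexity puts `H x - H z` minus the difference quotient in `K`;
  -- closedness passes this to the limit.
  have hlim := ((hz.hasFDerivAt.hasLineDerivAt (x - z)).tendsto_slope_zero_right).const_sub
    (H x - H z)
  refine K.isClosed.mem_of_tendsto hlim ?_
  filter_upwards [Ioc_mem_nhdsGT (zero_lt_one' ℝ)] with t ht
  have hmem := K.smul_mem (hH x z t ht.1.le ht.2) (inv_nonneg.2 ht.1.le)
  have hpt : t • x + (1 - t) • z = z + t • (x - z) := by module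
  rw [hpt] at hmem
  have h1 : H x - H z = t⁻¹ • (t • (H x - H z)) := (inv_smul_smul₀ ht.1.ne' _).symm
  have h2 : H x - H z - t⁻¹ • (H (z + t • (x - z)) - H z) =
      t⁻¹ • (t • H x + (1 - t) • H z - H (z + t • (x - z))) := by
    rw [h1, ← smul_sub]
    congr 1
    module
  rw [h2]
  exact hmem

theorem KConvex.linearized (hG : KConvex K G) (z : EuclideanSpace ℝ (Fin d)) :
    KConvex K (linearized G H z) := by
  intro x₁ x₂ α h0 h1
  have hpt : α • x₁ + (1 - α) • x₂ - z = α • (x₁ - z) + (1 - α) • (x₂ - z) := by module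
  have := hG x₁ x₂ α h0 h1
  unfold ConeLE ConeDC.linearized at *
  rw [hpt, map_add, map_smul, map_smul]
  convert this using 1
  module

theorem KConvex.convex_image_add {Φ : EuclideanSpace ℝ (Fin d) → Y} (hΦ : KConvex K Φ)
    {S : Set (EuclideanSpace ℝ (Fin d))} (hS : Convex ℝ S) :
    Convex ℝ (Φ '' S + (K : Set Y)) := by
  rintro _ ⟨_, ⟨x, hx, rfl⟩, k, hk, rfl⟩ _ ⟨_, ⟨y, hy, rfl⟩, l, hl, rfl⟩ a b ha hb hab
  obtain rfl : b = 1 - a := by linarith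
  refine ⟨_, ⟨a • x + (1 - a) • y, hS hx hy ha hb hab, rfl⟩,
    (a • Φ x + (1 - a) • Φ y - Φ (a • x + (1 - a) • y)) + (a • k + (1 - a) • l), ?_, ?_⟩
  · exact add_mem (hΦ x y a ha (by linarith))
      (add_mem (K.smul_mem hk ha) (K.smul_mem hl hb))
  · simp only
    module

theorem continuousOn_linearized (hG : ContinuousOn G A) (z : EuclideanSpace ℝ (Fin d)) :
    ContinuousOn (linearized G H z) A := by
  unfold linearized
  fun_prop

/-- Truncating `A` to a ball makes the image compact, and a compact set plus a closed one is closed.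
-/
theorem isClosed_image_add {Φ : EuclideanSpace ℝ (Fin d) → Y} (hA : IsClosed A)
    (hΦ : ContinuousOn Φ A) (R : ℝ) :
    IsClosed (Φ '' (A ∩ Metric.closedBall 0 R) + (K : Set Y)) := by
  refine K.isClosed.add_left_of_isCompact ?_
  exact ((isCompact_closedBall _ _).inter_left hA).image_of_continuousOn
    (hΦ.mono Set.inter_subset_left)

/-! ### Uniform Slater condition -/

/-- At a point of `slaterSet` a ball around `0` is covered using only a bounded part of `A`. -/
theorem exists_ball_subset_of_mem_slaterSet [CompleteSpace Y] (hA : IsClosed A)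
    (hAc : Convex ℝ A) (hG : KConvex K G) (hGc : ContinuousOn G A)
    {z : EuclideanSpace ℝ (Fin d)} (hz : z ∈ slaterSet K A G H) :
    ∃ r > 0, ∃ R : ℝ, Metric.ball (0 : Y) r ⊆
      linearized G H z '' (A ∩ Metric.closedBall 0 R) + (K : Set Y) := by
  obtain ⟨n, hn⟩ := exists_zero_mem_interior_of_monotone
    (C := fun n : ℕ => linearized G H z '' (A ∩ Metric.closedBall 0 n) + (K : Set Y))
    (fun m n hmn => by
      dsimp only
      gcongr)
    (fun n => isClosed_image_add hA (continuousOn_linearized hGc z) n)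
    (fun n => (hG.linearized z).convex_image_add (hAc.inter (convex_closedBall _ _)))
    (by
      refine interior_mono ?_ hz.2
      rintro y ⟨x, hx, k, hk, rfl⟩
      obtain ⟨n, hn⟩ := exists_nat_ge ‖x‖
      exact Set.mem_iUnion.2
        ⟨n, _, ⟨x, ⟨hx, mem_closedBall_zero_iff.2 hn⟩, rfl⟩, k, hk, rfl⟩)
  obtain ⟨r, hr, hball⟩ := Metric.mem_nhds_iff.1 (mem_interior_iff_mem_nhds.1 hn)
  exact ⟨r, hr, n, hball⟩

/-- `G` cancels in the difference, which is affine in `x` with coefficients tending to zero as `z'`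
tends to `z` in `A`. -/
theorem eventually_norm_linearized_sub_le (hH : ContDiffFrechetOn H A)
    {z : EuclideanSpace ℝ (Fin d)} (hz : z ∈ A) (R : ℝ) {ε : ℝ} (hε : 0 < ε) :
    ∀ᶠ z' in nhdsWithin z A, ∀ x ∈ Metric.closedBall (0 : EuclideanSpace ℝ (Fin d)) R,
      ‖linearized G H z' x - linearized G H z x‖ ≤ ε := by
  have hHc : ContinuousOn H A := fun x hx => (hH.1 x hx).continuousAt.continuousWithinAt
  have hD : ContinuousOn (fderiv ℝ H) A := hH.2
  have hcont : ContinuousOn (fun z' => ‖H z - H z'‖ + ‖fderiv ℝ H z - fderiv ℝ H z'‖ * R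
      + ‖fderiv ℝ H z' z' - fderiv ℝ H z z‖) A := by
    fun_prop
  have hlim := hcont z hz
  simp only [ContinuousWithinAt, sub_self, norm_zero, zero_mul, add_zero] at hlim
  filter_upwards [hlim.eventually (gt_mem_nhds hε)] with z' hz' x hx
  rw [mem_closedBall_zero_iff] at hx
  have heq : linearized G H z' x - linearized G H z x =
      (H z - H z') + (fderiv ℝ H z - fderiv ℝ H z') x + (fderiv ℝ H z' z' - fderiv ℝ H z z) := by
    simp only [linearized, map_sub, sub_apply]
    abel
  rw [heq]
  refine (norm_add₃_le).trans (le_trans ?_ hz'.le)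
  gcongr
  exact (ContinuousLinearMap.le_opNorm _ _).trans (by gcongr)

/-- Slater's condition holds uniformly on compact subsets of `slaterSet`. -/
theorem exists_uniform_slater [CompleteSpace Y] (hA : IsClosed A)
    (hAc : Convex ℝ A) (hG : KConvex K G) (hGc : ContinuousOn G A) (hH : ContDiffFrechetOn H A)
    {D₀ : Set (EuclideanSpace ℝ (Fin d))} (hD : IsCompact D₀) (hDs : D₀ ⊆ slaterSet K A G H) :
    ∃ r > 0, ∃ R : ℝ, ∀ z ∈ D₀, Metric.ball (0 : Y) r ⊆
      linearized G H z '' (A ∩ Metric.closedBall 0 R) + (K : Set Y) := by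
  refine hD.induction_on (p := fun s => ∃ r > 0, ∃ R : ℝ, ∀ z ∈ s, Metric.ball (0 : Y) r ⊆
    linearized G H z '' (A ∩ Metric.closedBall 0 R) + (K : Set Y)) ?_ ?_ ?_ ?_
  · exact ⟨1, one_pos, 0, by simp⟩
  · rintro s t hst ⟨r, hr, R, h⟩
    exact ⟨r, hr, R, fun z hz => h z (hst hz)⟩
  · rintro s t ⟨r, hr, R, h⟩ ⟨r', hr', R', h'⟩
    refine ⟨min r r', lt_min hr hr', max R R', ?_⟩
    rintro z (hz | hz)
    · refine (Metric.ball_subset_ball (min_le_left _ _)).trans ((h z hz).trans ?_)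
      gcongr
      exact le_max_left _ _
    · refine (Metric.ball_subset_ball (min_le_right _ _)).trans ((h' z hz).trans ?_)
      gcongr
      exact le_max_right _ _
  · intro z hz
    obtain ⟨r, hr, R, hball⟩ := exists_ball_subset_of_mem_slaterSet hA hAc hG hGc (hDs hz)
    refine ⟨_, nhdsWithin_mono z (fun w hw => (hDs hw).1)
      (eventually_norm_linearized_sub_le (G := G) hH (hDs hz).1 R (half_pos hr)),
      -- Half of the radius absorbs the perturbation of the linearization; the other half remains
      -- covered.
      r / 2, half_pos hr, R, fun z' hz' => ?_⟩
    refine ball_subset_of_forall_exists_norm_sub_le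
      ((hG.linearized z').convex_image_add (hAc.inter (convex_closedBall _ _)))
      (isClosed_image_add hA (continuousOn_linearized hGc z') R) (half_pos hr) (half_pos hr).le ?_
    intro y hy
    rw [add_halves] at hy
    obtain ⟨_, ⟨x, hx, rfl⟩, k, hk, rfl⟩ := hball hy
    refine ⟨_, ⟨_, ⟨x, hx, rfl⟩, k, hk, rfl⟩, ?_⟩
    simp only [add_sub_add_right_eq_sub]
    exact hz' x hx.2

/-! ### Coercivity and bounds on the objective -/

theorem CoerciveOn.exists_forall_le {φ : EuclideanSpace ℝ (Fin d) → ℝ} (hφ : CoerciveOn φ A)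
    (M : ℝ) : ∃ R : ℝ, ∀ x ∈ A, R ≤ ‖x‖ → M ≤ φ x := by
  by_contra! hcon
  choose u huA hun huM using fun n : ℕ => hcon n
  have hlim := hφ u huA (Filter.tendsto_atTop_mono hun tendsto_natCast_atTop_atTop)
  obtain ⟨n, hn⟩ := (hlim.eventually_ge_atTop M).exists
  exact absurd (huM n) (not_lt.2 hn)

theorem CoerciveOn.exists_le {φ : EuclideanSpace ℝ (Fin d) → ℝ} (hφ : CoerciveOn φ A)
    (hA : IsClosed A) (hc : ContinuousOn φ A) : ∃ m : ℝ, ∀ x ∈ A, m ≤ φ x := by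
  obtain ⟨R, hR⟩ := hφ.exists_forall_le 0
  obtain ⟨m, hm⟩ := ((isCompact_closedBall (0 : EuclideanSpace ℝ (Fin d)) R).inter_left
    hA).bddBelow_image (hc.mono Set.inter_subset_left)
  refine ⟨min m 0, fun x hx => ?_⟩
  rcases le_total R ‖x‖ with h | h
  · exact (min_le_right _ _).trans (hR x hx h)
  · exact (min_le_left _ _).trans (hm ⟨x, ⟨hx, mem_closedBall_zero_iff.2 h⟩, rfl⟩)

theorem continuous_of_convexOn_univ {f : EuclideanSpace ℝ (Fin d) → ℝ}
    (hf : ConvexOn ℝ Set.univ f) : Continuous f :=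
  continuousOn_univ.1 (hf.continuousOn isOpen_univ)

theorem continuousOn_penaltyFun (hg : Continuous g₀) (hh : Continuous h₀)
    (hG : ContinuousOn G A) (hH : ContinuousOn H A) (c : ℝ) :
    ContinuousOn (penaltyFun K g₀ h₀ G H c) A :=
  (hg.sub hh).continuousOn.add
    (continuousOn_const.mul ((Metric.continuous_infDist_pt _).comp_continuousOn (hG.sub hH)))

/-- On the feasible region of the penalized problem, the objective is minorized by the penalty
function. -/
theorem penaltyFun_add_le_objective (hH : KConvex K H) {z v x : EuclideanSpace ℝ (Fin d)} {s : Y}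
    (hz : DifferentiableAt ℝ H z) (hv : v ∈ subdifferential h₀ z) {c : ℝ} (hc : 0 ≤ c)
    (hs : ConeLE K (linearized G H z x) s) :
    penaltyFun K g₀ h₀ G H c x + h₀ z - c * ‖s‖ ≤ objective g₀ z v x := by
  have hdist : Metric.infDist (G x - H x) (-(K : Set Y)) ≤ ‖s‖ := by
    -- `s - (G x - H x)` is the sum of `s - F_z(x)` and the gap between `H x` and its linearization
    -- at `z`, both in `K`.
    have hmem : G x - H x - s ∈ -(K : Set Y) := by
      have := add_mem (s := K) hs (hH.sub_sub_fderiv_mem hz x)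
      have heq : -(G x - H x - s) =
          s - linearized G H z x + (H x - H z - fderiv ℝ H z (x - z)) := by
        unfold linearized
        abel
      rw [Set.mem_neg, heq]
      exact this
    refine (Metric.infDist_le_dist_of_mem hmem).trans ?_
    rw [dist_eq_norm, sub_sub_cancel]
  have := hv x
  have := mul_le_mul_of_nonneg_left hdist hc
  unfold penaltyFun objective
  linarith

/-- The subgradient inequality at the reflected point `2z - x` bounds `-⟪v, x - z⟫` from above,
giving a bound independent of `v`. -/
theorem objective_le_of_mem_subdifferential {z v : EuclideanSpace ℝ (Fin d)}
    (hv : v ∈ subdifferential h₀ z) (x : EuclideanSpace ℝ (Fin d)) :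
    objective g₀ z v x ≤ g₀ x + h₀ (z + (z - x)) - h₀ z := by
  have := hv (z + (z - x))
  rw [add_sub_cancel_left, ← neg_sub x z, inner_neg_right] at this
  unfold objective
  rw [neg_sub] at this
  linarith

theorem objective_combo_le (hg : ConvexOn ℝ Set.univ g₀) (z v : EuclideanSpace ℝ (Fin d))
    (x y : EuclideanSpace ℝ (Fin d)) {a : ℝ} (h0 : 0 ≤ a) (h1 : a ≤ 1) :
    objective g₀ z v (a • x + (1 - a) • y) ≤
      a * objective g₀ z v x + (1 - a) * objective g₀ z v y := by
  have := hg.2 (Set.mem_univ x) (Set.mem_univ y) h0 (sub_nonneg.2 h1) (by ring)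
  have hpt : a • x + (1 - a) • y - z = a • (x - z) + (1 - a) • (y - z) := by module
  simp only [smul_eq_mul] at this
  unfold objective
  rw [hpt, inner_add_right, inner_smul_right, inner_smul_right]
  linarith

/-! ### Exact penalization and existence of solutions -/

/-- A feasible point of the penalized problem can be moved to a feasible point of the linearized
problem at a cost proportional to the norm of the slack. -/
theorem exists_feasible_objective_le (hAc : Convex ℝ A) (hG : KConvex K G)
    (hg : ConvexOn ℝ Set.univ g₀) {z v x : EuclideanSpace ℝ (Fin d)} {s : Y} {r a b c : ℝ}
    (hr : 0 < r) (hab : b ≤ a) (hc : 0 ≤ c)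
    (hslater : ∀ y : Y, ‖y‖ ≤ r → ∃ x' ∈ A, objective g₀ z v x' ≤ a ∧
      ConeLE K (linearized G H z x') y)
    (hx : x ∈ A) (hs : ConeLE K (linearized G H z x) s)
    (hb : b - c * ‖s‖ ≤ objective g₀ z v x) :
    ∃ x' ∈ feasible K A G H z,
      objective g₀ z v x' ≤ objective g₀ z v x + ((a - b) / r + c) * ‖s‖ := by
  by_cases h0 : s = 0
  · subst h0
    exact ⟨x, ⟨hs, hx⟩, by simp⟩
  have hpos : 0 < ‖s‖ := norm_pos_iff.2 h0
  obtain ⟨w, hwA, hwa, hw⟩ := hslater (-((r / ‖s‖) • s)) (by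
    rw [norm_neg, norm_smul, Real.norm_of_nonneg (by positivity), div_mul_cancel₀ _ hpos.ne'])
  -- The weight solves `l * (r / ‖s‖) = 1 - l`, so the slacks of `w` and `x` cancel in the
  -- combination.
  obtain ⟨l, hl⟩ : ∃ l : ℝ, l = ‖s‖ / (‖s‖ + r) := ⟨_, rfl⟩
  have hl0 : 0 ≤ l := by rw [hl]; positivity
  have hl1 : l ≤ 1 := by rw [hl, div_le_one (by positivity)]; linarith
  refine ⟨l • w + (1 - l) • x, ⟨?_, hAc hwA hx hl0 (by linarith) (by ring)⟩, ?_⟩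
  · have h1 := hG.linearized (H := H) z w x l hl0 hl1
    have h2 := add_mem (s := K) h1
      (add_mem (K.smul_mem hw hl0) (K.smul_mem hs (sub_nonneg.2 hl1)))
    have hz : (1 - l) • s - l • (r / ‖s‖) • s = 0 := by
      rw [smul_smul, ← sub_smul]
      convert zero_smul ℝ s
      rw [hl]
      field_simp
      ring
    unfold ConeLE
    rw [← hz]
    convert h2 using 1
    module
  · have h1 := objective_combo_le hg z v w x hl0 hl1
    -- The gap between the objectives at `w` and `x` is at most `(a - b) + c * ‖s‖`; the first term
    -- is paid through `l ≤ ‖s‖ / r`, the second through `l ≤ 1`.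
    have h2 : l * (objective g₀ z v w - objective g₀ z v x) ≤ l * ((a - b) + c * ‖s‖) := by
      gcongr
      linarith
    have h3 : l * (a - b) ≤ (a - b) / r * ‖s‖ := by
      have : l ≤ ‖s‖ / r := by
        rw [hl]
        gcongr
        linarith
      calc l * (a - b) ≤ ‖s‖ / r * (a - b) := by gcongr
        _ = (a - b) / r * ‖s‖ := by ring
    have h4 : l * (c * ‖s‖) ≤ 1 * (c * ‖s‖) := by gcongr
    linarith

/-- The linearized problem has a globally optimal solution. -/
theorem exists_isSolution_objective (hA : IsClosed A) (hg : Continuous g₀)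
    (hG : ContinuousOn G A) (hH : KConvex K H) {z v : EuclideanSpace ℝ (Fin d)}
    (hz : DifferentiableAt ℝ H z) (hv : v ∈ subdifferential h₀ z) {c : ℝ} (hc : 0 ≤ c)
    (hcoer : CoerciveOn (penaltyFun K g₀ h₀ G H c) A) (hne : (feasible K A G H z).Nonempty) :
    ∃ x, IsSolution (objective g₀ z v) (feasible K A G H z) x := by
  obtain ⟨x₀, hx₀⟩ := hne
  have hclosed : IsClosed (feasible K A G H z) := by
    have := ((continuousOn_const (c := (0 : Y))).sub
      (continuousOn_linearized (H := H) hG z)).preimage_isClosed_of_isClosed hA K.isClosed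
    rw [Set.inter_comm] at this
    exact this
  have hcont : Continuous (objective g₀ z v) := by
    unfold objective
    fun_prop
  -- With zero slack the objective dominates the penalty function plus `h₀ z`, so far feasible
  -- points cannot beat `x₀`.
  obtain ⟨R, hR⟩ := hcoer.exists_forall_le (objective g₀ z v x₀ - h₀ z)
  obtain ⟨x, hx, hmin⟩ := hcont.continuousOn.exists_isMinOn' hclosed hx₀ (by
    rw [Filter.eventually_inf_principal]
    filter_upwards [(tendsto_norm_cocompact_atTop
      (E := EuclideanSpace ℝ (Fin d))).eventually_ge_atTop R] with x hx hxf
    have h1 := hR x hxf.2 hx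
    have h2 := penaltyFun_add_le_objective (g₀ := g₀) hH hz hv hc hxf.1
    simp only [norm_zero, mul_zero, sub_zero] at h2
    linarith)
  exact ⟨x, hx, isMinOn_iff.1 hmin⟩

end ConeDC

theorem mainTheorem10 {d : ℕ} {Y : Type*} [NormedAddCommGroup Y] [NormedSpace ℝ Y]
    [CompleteSpace Y]
    (K : ProperCone ℝ Y) (hK_pointed : ∀ y ∈ K, -y ∈ K → y = 0)
    (hK_fin : FiniteDimensional ℝ (Submodule.span ℝ (K : Set Y)))
    (A : Set (EuclideanSpace ℝ (Fin d))) (hA_closed : IsClosed A) (hA_convex : Convex ℝ A)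
    (g₀ h₀ : EuclideanSpace ℝ (Fin d) → ℝ)
    (hg₀ : ConvexOn ℝ Set.univ g₀) (hh₀ : ConvexOn ℝ Set.univ h₀)
    (G H : EuclideanSpace ℝ (Fin d) → Y)
    (hG_convex : ConeDC.KConvex K G) (hH_convex : ConeDC.KConvex K H)
    (hG_cont : ContinuousOn G A) (hH_diff : ConeDC.ContDiffFrechetOn H A)
    (h_coercive : ∃ c : ℝ, 0 ≤ c ∧ ConeDC.CoerciveOn (ConeDC.penaltyFun K g₀ h₀ G H c) A)
    (t₀ : Y →L[ℝ] ℝ) (ht₀ : ConeDC.StrictlyDualPositive K t₀)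
    (D₀ : Set (EuclideanSpace ℝ (Fin d))) (hD₀_compact : IsCompact D₀)
    (hD₀_slater : D₀ ⊆ ConeDC.slaterSet K A G H) :
    ∃ μ_star : ℝ, 0 ≤ μ_star ∧ ∀ μ : ℝ, μ_star ≤ μ →
      ∀ z ∈ D₀, ∀ v ∈ ConeDC.subdifferential h₀ z,
        (∃ p : EuclideanSpace ℝ (Fin d) × Y,
          ConeDC.IsSolution (ConeDC.penObjective g₀ t₀ μ z v) (ConeDC.penFeasible K A G H z) p) ∧
        ∀ (x : EuclideanSpace ℝ (Fin d)) (s : Y),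
          ConeDC.IsSolution (ConeDC.penObjective g₀ t₀ μ z v) (ConeDC.penFeasible K A G H z)
              (x, s) ↔
            s = 0 ∧ ConeDC.IsSolution (ConeDC.objective g₀ z v) (ConeDC.feasible K A G H z) x := by
  obtain ⟨c, hc, hcoer⟩ := h_coercive
  have hgc := ConeDC.continuous_of_convexOn_univ hg₀
  have hhc := ConeDC.continuous_of_convexOn_univ hh₀
  have hHc : ContinuousOn H A := fun x hx =>
    (hH_diff.1 x hx).continuousAt.continuousWithinAt
  obtain ⟨σ, hσ, ht⟩ := ht₀.exists_mul_norm_le hK_fin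
  obtain ⟨m, hm⟩ := hcoer.exists_le hA_closed
    (ConeDC.continuousOn_penaltyFun hgc hhc hG_cont hHc c)
  obtain ⟨r, hr, R, hslater⟩ := ConeDC.exists_uniform_slater hA_closed hA_convex hG_convex
    hG_cont hH_diff hD₀_compact hD₀_slater
  obtain ⟨b, hb⟩ := hD₀_compact.bddBelow_image hhc.continuousOn
  have hcompact := hD₀_compact.prod (isCompact_closedBall (0 : EuclideanSpace ℝ (Fin d)) R)
  obtain ⟨a, ha⟩ := hcompact.bddAbove_image
    (f := fun p => g₀ p.2 + h₀ (p.1 + (p.1 - p.2)) - h₀ p.1) (by fun_prop)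
  -- The maximum secures `m + b ≤ a'`, needed for `L ≥ 0`. The radius is halved because the covered
  -- ball is open.
  set a' := max a (m + b)
  have hL : 0 ≤ (a' - (m + b)) / (r / 2) + c := by
    have : m + b ≤ a' := le_max_right _ _
    have : 0 ≤ (a' - (m + b)) / (r / 2) := div_nonneg (by linarith) (by linarith)
    linarith
  set L := (a' - (m + b)) / (r / 2) + c
  -- `L` pays for removing the slack; the extra `1` leaves a margin `‖s‖` that forces `s = 0` at an
  -- optimum.
  refine ⟨(L + 1) / σ, by positivity, fun μ hμ z hz v hv => ?_⟩
  have hzA : z ∈ A := (hD₀_slater hz).1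
  have hzd := hH_diff.1 z hzA
  have hball : ∀ y : Y, ‖y‖ ≤ r / 2 → ∃ x' ∈ A, ConeDC.objective g₀ z v x' ≤ a' ∧
      ConeDC.ConeLE K (ConeDC.linearized G H z x') y := by
    intro y hy
    obtain ⟨_, ⟨x, hx, rfl⟩, k, hk, rfl⟩ :=
      hslater z hz (mem_ball_zero_iff.2 (by linarith : ‖y‖ < r))
    refine ⟨x, hx.1, ?_, by simpa [ConeDC.ConeLE] using hk⟩
    exact (ConeDC.objective_le_of_mem_subdifferential hv x).trans
      ((ha ⟨(z, x), ⟨hz, hx.2⟩, rfl⟩).trans (le_max_left _ _))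
  have hexact : ∀ p ∈ ConeDC.penFeasible K A G H z, ∃ x ∈ ConeDC.feasible K A G H z,
      ConeDC.objective g₀ z v x + ‖p.2‖ ≤ ConeDC.penObjective g₀ t₀ μ z v p := by
    rintro ⟨x, s⟩ ⟨hxs, hs, hx⟩
    have hs : s ∈ K := by simpa [ConeDC.ConeLE] using hs
    have hlow := ConeDC.penaltyFun_add_le_objective (g₀ := g₀) hH_convex hzd hv hc hxs
    have hbz : b ≤ h₀ z := hb ⟨z, hz, rfl⟩
    obtain ⟨x', hx', hle⟩ := ConeDC.exists_feasible_objective_le (b := m + b) hA_convex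
      hG_convex hg₀ (half_pos hr) (le_max_right a (m + b)) hc hball hx hxs
      (by linarith [hm x hx])
    refine ⟨x', hx', ?_⟩
    have h1 : (L + 1) * ‖s‖ ≤ μ * t₀ s := by
      rw [div_le_iff₀ hσ] at hμ
      have hμ0 : 0 ≤ μ := by
        by_contra! h
        nlinarith
      calc (L + 1) * ‖s‖ ≤ μ * σ * ‖s‖ := by gcongr
        _ = μ * (σ * ‖s‖) := by ring
        _ ≤ μ * t₀ s := by
          gcongr
          exact ht s hs
    have h2 : ConeDC.penObjective g₀ t₀ μ z v (x, s) =
        ConeDC.objective g₀ z v x + μ * t₀ s := rfl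
    have h3 : ConeDC.objective g₀ z v x' ≤ ConeDC.objective g₀ z v x + L * ‖s‖ := hle
    rw [h2]
    dsimp only
    linarith
  have hpen : ∀ x, ConeDC.penObjective g₀ t₀ μ z v (x, 0) = ConeDC.objective g₀ z v x :=
    fun x => by simp [ConeDC.penObjective, ConeDC.objective]
  have hfeas : ∀ x ∈ ConeDC.feasible K A G H z, (x, (0 : Y)) ∈ ConeDC.penFeasible K A G H z :=
    fun x hx => ⟨hx.1, by simp [ConeDC.ConeLE], hx.2⟩
  have hiff : ∀ (x : EuclideanSpace ℝ (Fin d)) (s : Y),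
      ConeDC.IsSolution (ConeDC.penObjective g₀ t₀ μ z v) (ConeDC.penFeasible K A G H z)
        (x, s) ↔
      s = 0 ∧ ConeDC.IsSolution (ConeDC.objective g₀ z v) (ConeDC.feasible K A G H z) x := by
    intro x s
    constructor
    · rintro ⟨hmem, hmin⟩
      obtain rfl : s = 0 := by
        obtain ⟨x', hx', hle⟩ := hexact _ hmem
        have := hmin _ (hfeas x' hx')
        rw [hpen] at this
        exact norm_le_zero_iff.1 (by dsimp only at hle; linarith)
      refine ⟨rfl, ⟨hmem.1, hmem.2.2⟩, fun q hq => ?_⟩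
      have := hmin _ (hfeas q hq)
      rwa [hpen, hpen] at this
    · rintro ⟨rfl, hmem, hmin⟩
      refine ⟨hfeas x hmem, fun q hq => ?_⟩
      obtain ⟨x', hx', hle⟩ := hexact q hq
      rw [hpen]
      linarith [hmin x' hx', norm_nonneg q.2]
  refine ⟨?_, hiff⟩
  -- The Slater property at `y = 0` supplies a feasible point of the linearized problem.
  obtain ⟨x₁, hx₁A, -, hx₁⟩ := hball 0 (by rw [norm_zero]; positivity)
  obtain ⟨x, hx⟩ := ConeDC.exists_isSolution_objective hA_closed hgc hG_cont hH_convex hzd hv hc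
    hcoer ⟨x₁, hx₁, hx₁A⟩
  exact ⟨(x, 0), (hiff x 0).2 ⟨rfl, hx⟩⟩
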